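/- Let $d\ge 1$ be an integer, let $\mu$ be a Borel probability measure on $\mathbb R^d$ and let $K\subset\mathbb R^d$ be a compact set on which $\mu$ is supported, i.e. $\mu(\mathbb R^d\setminus K)=0$. Let $\gamma$ be a real number with $d/2\le\gamma<d$, and suppose that there is a constant $C\ge 1$ such that $$C^{-1}r^\gamma\le\mu(B(x,r))\le C r^\gamma\qquad\text{for all }x\in K\text{ and all }0<r<1,$$ where $B(x,r)$ is the open Euclidean ball of radius $r$ centred at $x$. Let $\hat\mu(\xi)=\int_{\mathbb R^d}e^{-2\pi i\langle\xi,x\rangle}\,d\mu(x)$ for $\xi\in\mathbb R^d$. Then $\|\hat\mu\|_{L^{2d/\gamma}(\mathbb R^d)}=\infty$, the norm being taken with respect to Lebesgue measure; that is, $\hat\mu\notin L^{2d/\gamma}(\mathbb R^d)$. -/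

import Mathlib

open MeasureTheory

/-- The Fourier transform `ξ ↦ ∫ exp (-2π i ⟨ξ, x⟩) dμ(x)` of a Borel measure on `ℝᵈ`. -/
noncomputable def measureFourier {d : ℕ} (μ : Measure (EuclideanSpace ℝ (Fin d)))
    (ξ : EuclideanSpace ℝ (Fin d)) : ℂ :=
  ∫ x, Complex.exp (-2 * (Real.pi : ℂ) * Complex.I * ((inner ℝ ξ x : ℝ) : ℂ)) ∂μ

/-!
Suppose that `μ̂` lies in `L^p` with `p = 2d/γ`, and test `|μ̂|²` against the Gaussian
`g_R(ξ) = exp (-π |ξ|² / R²)`.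

On the one hand, `∫ |μ̂|² g_R = R^d ∬ exp (-π R² |x - y|²) dμ(x) dμ(y)`, and the lower bound on the
measure of balls of radius `1 / R` makes the right-hand side at least a constant times `R^(d - γ)`
(`rpow_le_lintegral_measureFourier_sq_mul_gaussian`).

On the other hand, Hölder's inequality with exponent `d/γ` on `|μ̂|²` and its conjugate on `g_R`
bounds the integral over any set by `‖μ̂‖_p²`, taken over this set, times `R^(d - γ)`. The exponents
are the same, but the factor `‖μ̂‖_p` is as small as desired away from a suitable set of finite
volume, while on that set the integral is at most its volume because `|μ̂| ≤ 1`. Hence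
`c R^(d - γ) ≤ V + (c / 2) R^(d - γ)` for all `R > 1`, which is absurd as `R → ∞`
since `γ < d`.
-/

open scoped ENNReal

lemma measureFourier_eq_charFun {d : ℕ} (μ : Measure (EuclideanSpace ℝ (Fin d)))
    (ξ : EuclideanSpace ℝ (Fin d)) :
    measureFourier μ ξ = charFun μ ((-2 * Real.pi) • ξ) := by
  rw [measureFourier, charFun_apply]
  congr with x
  rw [inner_smul_right, real_inner_comm]
  push_cast
  ring_nf

lemma measurable_measureFourier {d : ℕ} (μ : Measure (EuclideanSpace ℝ (Fin d)))
    [IsProbabilityMeasure μ] : Measurable (measureFourier μ) := by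
  have : measureFourier μ = fun ξ ↦ charFun μ ((-2 * Real.pi) • ξ) :=
    funext (measureFourier_eq_charFun μ)
  rw [this]
  exact measurable_charFun.comp (measurable_const_smul _)

lemma norm_measureFourier_le_one {d : ℕ} (μ : Measure (EuclideanSpace ℝ (Fin d)))
    [IsProbabilityMeasure μ] (ξ : EuclideanSpace ℝ (Fin d)) : ‖measureFourier μ ξ‖ ≤ 1 := by
  rw [measureFourier_eq_charFun]
  exact norm_charFun_le_one _

lemma norm_measureFourier_sq_eq_integral_prod {d : ℕ} (μ : Measure (EuclideanSpace ℝ (Fin d)))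
    [IsProbabilityMeasure μ] (ξ : EuclideanSpace ℝ (Fin d)) :
    ((‖measureFourier μ ξ‖ ^ 2 : ℝ) : ℂ) =
      ∫ z, Complex.exp (-2 * Real.pi * Complex.I * ((inner ℝ (z.1 - z.2) ξ : ℝ) : ℂ))
        ∂(μ.prod μ) := by
  push_cast
  rw [← Complex.mul_conj']
  unfold measureFourier
  rw [← integral_conj, ← integral_prod_mul]
  congr with z
  rw [← Complex.exp_conj, ← Complex.exp_add, inner_sub_left, real_inner_comm z.1 ξ,
    real_inner_comm z.2 ξ]
  congr 1
  simp [map_ofNat (starRingEnd ℂ) 2]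
  ring

lemma integrable_gaussian {d : ℕ} {b : ℝ} (hb : 0 < b) :
    Integrable (fun ξ : EuclideanSpace ℝ (Fin d) ↦ Real.exp (-b * ‖ξ‖ ^ 2)) := by
  have := (GaussianFourier.integrable_cexp_neg_mul_sq_norm_add
    (V := EuclideanSpace ℝ (Fin d)) (b := b) (by simpa using hb) 0 0).norm
  refine this.congr (.of_forall fun ξ ↦ ?_)
  simp [Complex.norm_exp, ← Complex.ofReal_pow]

/-- The Gaussian `exp (-π |ξ|² / R²)` has Fourier transform `R^d exp (-π R² |x|²)`, so by Fubini
the integral of `|μ̂|²` against it is a Gaussian energy of `μ`. -/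
lemma integral_measureFourier_sq_mul_gaussian {d : ℕ} (μ : Measure (EuclideanSpace ℝ (Fin d)))
    [IsProbabilityMeasure μ] {R : ℝ} (hR : 0 < R) :
    ∫ ξ, ‖measureFourier μ ξ‖ ^ 2 * Real.exp (-(Real.pi / R ^ 2) * ‖ξ‖ ^ 2) =
      R ^ d * ∫ z, Real.exp (-Real.pi * R ^ 2 * ‖z.1 - z.2‖ ^ 2) ∂(μ.prod μ) := by
  have hb : 0 < Real.pi / R ^ 2 := by positivity
  have hconst : (((Real.pi : ℂ) / ((Real.pi / R ^ 2 : ℝ) : ℂ)) ^ ((d : ℂ) / 2)) = (R : ℂ) ^ d := by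
    have h1 : (Real.pi : ℂ) / ((Real.pi / R ^ 2 : ℝ) : ℂ) = ((R ^ 2 : ℝ) : ℂ) := by
      have : Real.pi ≠ 0 := Real.pi_ne_zero
      rw [← Complex.ofReal_div]
      congr 1
      field_simp
    have h2 : ((d : ℂ) / 2) = ((d / 2 : ℝ) : ℂ) := by push_cast; rfl
    rw [h1, h2, ← Complex.ofReal_cpow (by positivity), ← Complex.ofReal_pow]
    congr 1
    rw [← Real.rpow_natCast R 2, ← Real.rpow_mul hR.le, ← Real.rpow_natCast]
    congr 1
    push_cast
    ring
  have key : ∀ z : EuclideanSpace ℝ (Fin d) × EuclideanSpace ℝ (Fin d),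
      ∫ ξ : EuclideanSpace ℝ (Fin d), Complex.exp (-((Real.pi / R ^ 2 : ℝ) : ℂ) * ‖ξ‖ ^ 2 +
        -2 * Real.pi * Complex.I * ((inner ℝ (z.1 - z.2) ξ : ℝ) : ℂ)) =
      ((R ^ d * Real.exp (-Real.pi * R ^ 2 * ‖z.1 - z.2‖ ^ 2) : ℝ) : ℂ) := by
    intro z
    rw [GaussianFourier.integral_cexp_neg_mul_sq_norm_add (by rwa [Complex.ofReal_re]),
      finrank_euclideanSpace_fin, hconst]
    push_cast
    congr 2
    have : (Real.pi : ℂ) ≠ 0 := by simp [Real.pi_ne_zero]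
    have : (R : ℂ) ≠ 0 := by simp [hR.ne']
    field_simp
    rw [Complex.I_sq]
    ring
  have hint : Integrable (Function.uncurry fun (ξ : EuclideanSpace ℝ (Fin d))
      (z : EuclideanSpace ℝ (Fin d) × EuclideanSpace ℝ (Fin d)) ↦
      Complex.exp (-((Real.pi / R ^ 2 : ℝ) : ℂ) * ‖ξ‖ ^ 2 +
        -2 * Real.pi * Complex.I * ((inner ℝ (z.1 - z.2) ξ : ℝ) : ℂ)))
      (volume.prod (μ.prod μ)) := by
    refine ((integrable_gaussian (d := d) hb).comp_fst (μ.prod μ)).mono'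
      (Continuous.aestronglyMeasurable (by unfold Function.uncurry; fun_prop))
      (.of_forall fun p ↦ le_of_eq ?_)
    simp [Function.uncurry, Complex.norm_exp, ← Complex.ofReal_pow]
  rw [← integral_const_mul]
  apply Complex.ofReal_injective
  rw [← integral_complex_ofReal, ← integral_complex_ofReal]
  simp_rw [← key]
  rw [← integral_integral_swap hint]
  congr with ξ
  rw [Complex.ofReal_mul, norm_measureFourier_sq_eq_integral_prod, ← integral_mul_const]
  congr with z
  rw [Complex.exp_add, mul_comm]
  push_cast
  rfl

/-- A lower bound for the Gaussian energy at scale `1 / R` by the lower regularity of `μ`: only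
the pairs of points at distance less than `1 / R` are needed. -/
lemma le_integral_gaussian_dist {d : ℕ} (μ : Measure (EuclideanSpace ℝ (Fin d)))
    [IsProbabilityMeasure μ] {R a : ℝ} (hR : 0 < R)
    (ha : ∀ᵐ x ∂μ, a ≤ μ.real (Metric.ball x R⁻¹)) :
    Real.exp (-Real.pi) * a ≤
      ∫ z, Real.exp (-Real.pi * R ^ 2 * ‖z.1 - z.2‖ ^ 2) ∂(μ.prod μ) := by
  have hle : ∀ z : EuclideanSpace ℝ (Fin d) × EuclideanSpace ℝ (Fin d),
      Real.exp (-Real.pi * R ^ 2 * ‖z.1 - z.2‖ ^ 2) ≤ 1 := fun z ↦ by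
    rw [Real.exp_le_one_iff]
    have := Real.pi_pos
    have : 0 ≤ Real.pi * R ^ 2 * ‖z.1 - z.2‖ ^ 2 := by positivity
    linarith
  have hint : Integrable (fun z : EuclideanSpace ℝ (Fin d) × EuclideanSpace ℝ (Fin d) ↦
      Real.exp (-Real.pi * R ^ 2 * ‖z.1 - z.2‖ ^ 2)) (μ.prod μ) := by
    refine (integrable_const (1 : ℝ)).mono' (Continuous.aestronglyMeasurable (by fun_prop))
      (.of_forall fun z ↦ ?_)
    rw [Real.norm_of_nonneg (Real.exp_pos _).le]
    exact hle z
  rw [integral_prod _ hint]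
  have hstep : ∀ᵐ x ∂μ, Real.exp (-Real.pi) * a ≤
      ∫ y, Real.exp (-Real.pi * R ^ 2 * ‖x - y‖ ^ 2) ∂μ := by
    filter_upwards [ha, hint.prod_right_ae] with x hx hxi
    calc Real.exp (-Real.pi) * a ≤ μ.real (Metric.ball x R⁻¹) * Real.exp (-Real.pi) := by
          rw [mul_comm]; gcongr
      _ = ∫ y in Metric.ball x R⁻¹, Real.exp (-Real.pi) ∂μ := by
          rw [setIntegral_const, smul_eq_mul]
      _ ≤ ∫ y in Metric.ball x R⁻¹, Real.exp (-Real.pi * R ^ 2 * ‖x - y‖ ^ 2) ∂μ := by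
          refine setIntegral_mono_on (integrable_const _) hxi.integrableOn
            measurableSet_ball fun y hy ↦ Real.exp_le_exp.2 ?_
          rw [Metric.mem_ball, dist_comm, dist_eq_norm] at hy
          have h1 : R * ‖x - y‖ ≤ 1 := by
            rw [← mul_inv_cancel₀ hR.ne']
            gcongr
          have h2 : (R * ‖x - y‖) ^ 2 ≤ 1 := pow_le_one₀ (by positivity) h1
          have := mul_le_mul_of_nonneg_left h2 Real.pi_pos.le
          linarith
      _ ≤ ∫ y, Real.exp (-Real.pi * R ^ 2 * ‖x - y‖ ^ 2) ∂μ :=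
          setIntegral_le_integral hxi (.of_forall fun _ ↦ (Real.exp_pos _).le)
  have := integral_mono_ae (integrable_const _) hint.integral_prod_left hstep
  simpa using this

lemma rpow_le_lintegral_measureFourier_sq_mul_gaussian {d : ℕ}
    (μ : Measure (EuclideanSpace ℝ (Fin d))) [IsProbabilityMeasure μ] {R c γ : ℝ} (hR : 0 < R)
    (hc : ∀ᵐ x ∂μ, c * R⁻¹ ^ γ ≤ μ.real (Metric.ball x R⁻¹)) :
    ENNReal.ofReal (Real.exp (-Real.pi) * c * R ^ (d - γ)) ≤
      ∫⁻ ξ, ‖measureFourier μ ξ‖ₑ ^ 2 *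
        ENNReal.ofReal (Real.exp (-(Real.pi / R ^ 2) * ‖ξ‖ ^ 2)) := by
  have hb : 0 < Real.pi / R ^ 2 := by positivity
  have hint : Integrable (fun ξ ↦ ‖measureFourier μ ξ‖ ^ 2 *
      Real.exp (-(Real.pi / R ^ 2) * ‖ξ‖ ^ 2)) := by
    refine (integrable_gaussian hb).mono' (((measurable_measureFourier μ).norm.pow_const 2).mul
      (by fun_prop)).aestronglyMeasurable (.of_forall fun ξ ↦ ?_)
    rw [Real.norm_of_nonneg (by positivity)]
    exact mul_le_of_le_one_left (Real.exp_pos _).le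
      (pow_le_one₀ (norm_nonneg _) (norm_measureFourier_le_one μ ξ))
  have heq : ∀ ξ, ‖measureFourier μ ξ‖ₑ ^ 2 *
      ENNReal.ofReal (Real.exp (-(Real.pi / R ^ 2) * ‖ξ‖ ^ 2)) = ENNReal.ofReal
        (‖measureFourier μ ξ‖ ^ 2 * Real.exp (-(Real.pi / R ^ 2) * ‖ξ‖ ^ 2)) := fun ξ ↦ by
    rw [ENNReal.ofReal_mul (by positivity), ENNReal.ofReal_pow (norm_nonneg _), ofReal_norm]
  simp_rw [heq]
  rw [← ofReal_integral_eq_lintegral_ofReal hint (.of_forall fun ξ ↦ by positivity),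
    integral_measureFourier_sq_mul_gaussian μ hR]
  refine ENNReal.ofReal_le_ofReal ?_
  calc Real.exp (-Real.pi) * c * R ^ (d - γ)
      = R ^ d * (Real.exp (-Real.pi) * (c * R⁻¹ ^ γ)) := by
        rw [Real.rpow_sub hR, Real.rpow_natCast, Real.inv_rpow hR.le]
        ring
    _ ≤ _ := by
        gcongr
        exact le_integral_gaussian_dist μ hR hc

/-- The `L^q` norm of `exp (-π |ξ|² / R²)` is at most `R^(d/q)` when `q ≥ 1`. -/
lemma lintegral_gaussian_rpow_le {d : ℕ} {R q : ℝ} (hR : 0 < R) (hq : 1 ≤ q) :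
    (∫⁻ ξ : EuclideanSpace ℝ (Fin d),
      ENNReal.ofReal (Real.exp (-(Real.pi / R ^ 2) * ‖ξ‖ ^ 2)) ^ q) ^ (1 / q) ≤
      ENNReal.ofReal (R ^ (d / q)) := by
  have hb : 0 < Real.pi / R ^ 2 := by positivity
  have hq0 : 0 < q := one_pos.trans_le hq
  have hle : ∫⁻ ξ : EuclideanSpace ℝ (Fin d),
      ENNReal.ofReal (Real.exp (-(Real.pi / R ^ 2) * ‖ξ‖ ^ 2)) ^ q ≤
      ENNReal.ofReal (R ^ (d : ℝ)) := by
    calc ∫⁻ ξ : EuclideanSpace ℝ (Fin d),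
          ENNReal.ofReal (Real.exp (-(Real.pi / R ^ 2) * ‖ξ‖ ^ 2)) ^ q
        ≤ ∫⁻ ξ : EuclideanSpace ℝ (Fin d),
          ENNReal.ofReal (Real.exp (-(Real.pi / R ^ 2) * ‖ξ‖ ^ 2)) := by
          refine lintegral_mono fun ξ ↦ ENNReal.rpow_le_self_of_le_one ?_ hq
          rw [ENNReal.ofReal_le_one, Real.exp_le_one_iff, neg_mul, neg_nonpos]
          positivity
      _ = ENNReal.ofReal (R ^ (d : ℝ)) := by
          rw [← ofReal_integral_eq_lintegral_ofReal (integrable_gaussian hb)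
            (.of_forall fun ξ ↦ (Real.exp_pos _).le),
            GaussianFourier.integral_rexp_neg_mul_sq_norm hb, finrank_euclideanSpace_fin]
          have h1 : Real.pi / (Real.pi / R ^ 2) = R ^ 2 := by
            have : Real.pi ≠ 0 := Real.pi_ne_zero
            field_simp
          rw [h1, ← Real.rpow_natCast R 2, ← Real.rpow_mul hR.le]
          congr 2
          push_cast
          ring
  calc _ ≤ ENNReal.ofReal (R ^ (d : ℝ)) ^ (1 / q) := ENNReal.rpow_le_rpow hle (by positivity)
    _ = ENNReal.ofReal (R ^ (d / q)) := by
      rw [ENNReal.ofReal_rpow_of_nonneg (by positivity) (by positivity), ← Real.rpow_mul hR.le]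
      congr 2
      ring

/-- Splitting the integral of `|μ̂|²` against a Gaussian: the trivial bound `|μ̂| ≤ 1` on `s`,
Hölder's inequality with exponent `d / γ` off `s`. -/
lemma lintegral_measureFourier_sq_mul_gaussian_le {d : ℕ}
    (μ : Measure (EuclideanSpace ℝ (Fin d))) [IsProbabilityMeasure μ] {R γ : ℝ} (hR : 0 < R)
    (hγ : 0 < γ) (hγd : γ < d) {s : Set (EuclideanSpace ℝ (Fin d))} (hs : MeasurableSet s) :
    ∫⁻ ξ, ‖measureFourier μ ξ‖ₑ ^ 2 *
        ENNReal.ofReal (Real.exp (-(Real.pi / R ^ 2) * ‖ξ‖ ^ 2)) ≤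
      volume s + (∫⁻ ξ in sᶜ, ‖measureFourier μ ξ‖ₑ ^ (2 * d / γ)) ^ (γ / d) *
        ENNReal.ofReal (R ^ (d - γ)) := by
  have hd : (0 : ℝ) < d := hγ.trans hγd
  have hpq : (d / γ).HolderConjugate (d / (d - γ)) := by
    rw [Real.holderConjugate_iff, one_lt_div hγ, inv_div, inv_div]
    exact ⟨hγd, by field_simp; ring⟩
  have hmeas := (measurable_measureFourier μ).enorm.pow_const 2
  rw [← lintegral_add_compl _ hs]
  gcongr
  · calc _ ≤ ∫⁻ ξ in s, 1 := by
          refine lintegral_mono fun ξ ↦ mul_le_one' (pow_le_one' ?_ 2) ?_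
          · rw [← ofReal_norm, ENNReal.ofReal_le_one]
            exact norm_measureFourier_le_one μ ξ
          · rw [ENNReal.ofReal_le_one, Real.exp_le_one_iff, neg_mul, neg_nonpos]
            positivity
      _ = volume s := setLIntegral_one s
  · refine (ENNReal.lintegral_mul_le_Lp_mul_Lq (volume.restrict sᶜ) hpq hmeas.aemeasurable
      (by fun_prop)).trans ?_
    gcongr ?_ * ?_
    · rw [one_div_div]
      refine le_of_eq ?_
      congr with ξ
      rw [← ENNReal.rpow_natCast, ← ENNReal.rpow_mul]
      congr 1
      push_cast
      ring
    · have hle := lintegral_gaussian_rpow_le (d := d) hR hpq.symm.lt.le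
      rw [div_div_cancel₀ hd.ne'] at hle
      refine le_trans ?_ hle
      exact ENNReal.rpow_le_rpow (setLIntegral_le_lintegral _ _) hpq.symm.one_div_nonneg

theorem mainTheorem3 (d : ℕ) (μ : Measure (EuclideanSpace ℝ (Fin d))) [IsProbabilityMeasure μ]
    (K : Set (EuclideanSpace ℝ (Fin d))) (hK : IsCompact K) (hμK : μ Kᶜ = 0)
    (γ : ℝ) (hγ : (d : ℝ) / 2 ≤ γ) (hγd : γ < (d : ℝ))
    (hAD : ∃ C : ℝ, 1 ≤ C ∧ ∀ x ∈ K, ∀ r : ℝ, 0 < r → r < 1 →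
      C⁻¹ * r ^ γ ≤ μ.real (Metric.ball x r) ∧ μ.real (Metric.ball x r) ≤ C * r ^ γ) :
    eLpNorm (measureFourier μ) (ENNReal.ofReal (2 * (d : ℝ) / γ)) volume = ⊤ := by
  obtain ⟨C, hC, hAD⟩ := hAD
  have hγ0 : 0 < γ := by
    have : (0 : ℝ) ≤ d := Nat.cast_nonneg d
    linarith
  have hd : (0 : ℝ) < d := hγ0.trans hγd
  have hp : 0 < 2 * (d : ℝ) / γ := by positivity
  by_contra hfin
  have hfin' := lintegral_rpow_enorm_lt_top_of_eLpNorm_lt_top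
    (ENNReal.ofReal_pos.2 hp).ne' ENNReal.ofReal_ne_top (lt_top_iff_ne_top.2 hfin)
  rw [ENNReal.toReal_ofReal hp.le] at hfin'
  set c : ℝ := Real.exp (-Real.pi) * C⁻¹ with hcdef
  have hc : 0 < c := by positivity
  -- The tail of `∫ |μ̂|^p` is made so small that its power `γ / d` is at most `c / 2`.
  obtain ⟨s, hs, hsfin, htail⟩ := exists_setLIntegral_compl_lt hfin'.ne
    (ENNReal.ofReal_pos.2 (show 0 < (c / 2) ^ (d / γ) by positivity)).ne'
  have htail' : (∫⁻ ξ in sᶜ, ‖measureFourier μ ξ‖ₑ ^ (2 * d / γ)) ^ (γ / d) ≤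
      ENNReal.ofReal (c / 2) := by
    refine (ENNReal.rpow_le_rpow htail.le (by positivity)).trans_eq ?_
    rw [ENNReal.ofReal_rpow_of_pos (by positivity), ← Real.rpow_mul (by positivity),
      div_mul_div_cancel₀ hγ0.ne', div_self hd.ne', Real.rpow_one]
  have hbound : ∀ R : ℝ, 1 < R → c / 2 * R ^ (d - γ) ≤ volume.real s := by
    intro R hR
    have hR0 : 0 < R := one_pos.trans hR
    have hlow : ∀ᵐ x ∂μ, C⁻¹ * R⁻¹ ^ γ ≤ μ.real (Metric.ball x R⁻¹) := by
      filter_upwards [mem_ae_iff.2 hμK] with x hx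
      exact (hAD x hx R⁻¹ (by positivity) (inv_lt_one_of_one_lt₀ hR)).1
    have h := (rpow_le_lintegral_measureFourier_sq_mul_gaussian μ hR0 hlow).trans
      ((lintegral_measureFourier_sq_mul_gaussian_le μ hR0 hγ0 hγd hs).trans
        (add_le_add_right (mul_le_mul_left htail' _) _))
    rw [← ofReal_measureReal hsfin.ne, ← ENNReal.ofReal_mul (by positivity),
      ← ENNReal.ofReal_add (by positivity) (by positivity),
      ENNReal.ofReal_le_ofReal_iff (by positivity), ← hcdef] at h
    linarith
  have htend := ((tendsto_rpow_atTop (sub_pos.2 hγd)).const_mul_atTop (half_pos hc))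
  obtain ⟨R, hRs, hR⟩ := ((htend.eventually_gt_atTop (volume.real s)).and
    (Filter.eventually_gt_atTop 1)).exists
  exact absurd (hbound R hR) (not_le.2 hRs)
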